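/- The full Lambek calculus $\mathbf{FL}$ is formulated with sequents $\Gamma\Rightarrow\Delta$, where $\Gamma$ is a finite (possibly empty) sequence of formulas and $\Delta$ is a sequence of at most one formula, in the language with the binary connectives $\vee$ (disjunction), $\wedge$ (additive conjunction), $*$ (fusion), $\backslash$ and $/$ (right and left implication), the unary connectives right negation ($\varphi\mapsto\varphi^{\backprime}$) and left negation ($\varphi\mapsto{}'\varphi$), and the constants $0,1$. Its rules are the axiom $\varphi\Rightarrow\varphi$, cut, and the usual left and right introduction rules of these connectives; those for the negations are $$\frac{\Gamma\Rightarrow\varphi}{\Gamma,\varphi^{\backprime}\Rightarrow\emptyset},\qquad \frac{\varphi,\Gamma\Rightarrow\emptyset}{\Gamma\Rightarrow\varphi^{\backprime}},\qquad \frac{\Gamma\Rightarrow\varphi}{{}'\varphi,\Gamma\Rightarrow\emptyset},\qquad \frac{\Gamma,\varphi\Rightarrow\emptyset}{\Gamma\Rightarrow{}'\varphi}.$$ For a subsequence $\sigma$ (possibly empty) of $e\,w_l\,w_r\,c$, let $\mathbf{FL}_\sigma$ be $\mathbf{FL}$ together with those of the rules exchange ($e$), left weakening ($w_l$), right weakening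 ($w_r$: from $\Gamma\Rightarrow\emptyset$ infer $\Gamma\Rightarrow\varphi$) and contraction ($c$) whose letters occur in $\sigma$. For a sublanguage $\Psi$, let $\mathbf{FL}_\sigma[\Psi]$ be the calculus on $\Psi$-formulas obtained by dropping the introduction rules of the connectives not in $\Psi$. The external system $\mathfrak{e}\mathcal{FL}_\sigma[\Psi]$ is the Hilbert system on $\Psi$-formulas in which $\Sigma\vdash\varphi$ holds iff the sequent $\emptyset\Rightarrow\varphi$ is derivable in $\mathbf{FL}_\sigma[\Psi]$ from the sequents $\emptyset\Rightarrow\psi$ with $\psi\in\Sigma$. A Hilbert system is protoalgebraic if $T_1\subseteq T_2$ implies $\Omega T_1\subseteq\Omega T_2$ for all its theories $T_1,T_2$, where the Leibniz congruence $\Omega T$ is the largest congruence $\theta$ of the formula algebra that is compatible with $T$ (i.e. $\alpha\in T$ and $\langle\alpha,\beta\rangle\in\theta$ imply $\beta\in T$). **Theorem 29.** For every subsequence $\sigma$ of $e\,w_l\,w_r\,c$, none of the four Hilbert systems $$\mathfrak{e}\mathcal{FL}_\sigma[\vee,*,0,1],\quad \mathfrak{e}\mathcal{FL}_\sigma[\vee,\wedge,*,0,1],\quad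 \mathfrak{e}\mathcal{FL}_\sigma[\vee,*,{}^{\backprime},{}',0,1],\quad \mathfrak{e}\mathcal{FL}_\sigma[\vee,\wedge,*,{}^{\backprime},{}',0,1]$$ is protoalgebraic. -/

import Mathlib

namespace FullLambek

/-- The connectives of the full Lambek calculus: disjunction, (additive) conjunction, fusion,
right implication, left implication, right negation, left negation, zero, one. -/
inductive Conn : Type
  | or | and | mul | rimp | limp | rneg | lneg | zero | one

/-- A sublanguage is a set of connectives. `Fm Ψ` is the carrier of the absolutely free algebra
of type `Ψ` over a countably infinite set of variables: a connective may be used only if it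
belongs to `Ψ`. -/
inductive Fm (Ψ : Set Conn) : Type
  | var : ℕ → Fm Ψ
  /-- `φ ∨ ψ` -/
  | or : Conn.or ∈ Ψ → Fm Ψ → Fm Ψ → Fm Ψ
  /-- `φ ∧ ψ` -/
  | and : Conn.and ∈ Ψ → Fm Ψ → Fm Ψ → Fm Ψ
  /-- `φ * ψ` -/
  | mul : Conn.mul ∈ Ψ → Fm Ψ → Fm Ψ → Fm Ψ
  /-- `rimp _ φ ψ` is the right implication with antecedent `φ` and consequent `ψ` -/
  | rimp : Conn.rimp ∈ Ψ → Fm Ψ → Fm Ψ → Fm Ψ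
  /-- `limp _ ψ φ` is the left implication `ψ / φ`, with antecedent `φ` and consequent `ψ` -/
  | limp : Conn.limp ∈ Ψ → Fm Ψ → Fm Ψ → Fm Ψ
  /-- the right negation of `φ` -/
  | rneg : Conn.rneg ∈ Ψ → Fm Ψ → Fm Ψ
  /-- the left negation of `φ` -/
  | lneg : Conn.lneg ∈ Ψ → Fm Ψ → Fm Ψ
  | zero : Conn.zero ∈ Ψ → Fm Ψ
  | one : Conn.one ∈ Ψ → Fm Ψ

/-- The endomorphism of the formula algebra determined by its values on the variables. -/
def Fm.subst {Ψ : Set Conn} (f : ℕ → Fm Ψ) : Fm Ψ → Fm Ψ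
  | .var n => f n
  | .or h φ ψ => .or h (φ.subst f) (ψ.subst f)
  | .and h φ ψ => .and h (φ.subst f) (ψ.subst f)
  | .mul h φ ψ => .mul h (φ.subst f) (ψ.subst f)
  | .rimp h φ ψ => .rimp h (φ.subst f) (ψ.subst f)
  | .limp h ψ φ => .limp h (ψ.subst f) (φ.subst f)
  | .rneg h φ => .rneg h (φ.subst f)
  | .lneg h φ => .lneg h (φ.subst f)
  | .zero h => .zero h
  | .one h => .one h

/-- Sequents with a finite sequence of formulas on the left and at most one formula on the
right. -/
structure Sequent (Ψ : Set Conn) : Type where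
  ante : List (Fm Ψ)
  succ : Option (Fm Ψ)

/-- Substitution in sequents. -/
def Sequent.subst {Ψ : Set Conn} (f : ℕ → Fm Ψ) (s : Sequent Ψ) : Sequent Ψ :=
  ⟨s.ante.map (Fm.subst f), s.succ.map (Fm.subst f)⟩

/-- The letters `e` (exchange), `wl` (left weakening), `wr` (right weakening), `c` (contraction).
A subsequence of `e wl wr c` is the same thing as a set of letters. -/
inductive Letter : Type
  | e | wl | wr | c

/-- `Derives σ Ψ Φ s`: the sequent `s` has a proof from the set of sequents `Φ` in the calculus
in the language `Ψ` whose rules are axiom, cut, the introduction rules of the full Lambek calculus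
for the connectives in `Ψ`, and the structural rules codified by the letters in `σ`.
Each rule is preceded by the membership of its connective in `Ψ` or of its letter in `σ`. -/
inductive Derives (σ : Set Letter) (Ψ : Set Conn) (Φ : Set (Sequent Ψ)) : Sequent Ψ → Prop
  | hyp {s : Sequent Ψ} : s ∈ Φ → Derives σ Ψ Φ s
  | ax (φ : Fm Ψ) : Derives σ Ψ Φ ⟨[φ], some φ⟩
  | cut {Γ S P : List (Fm Ψ)} {φ : Fm Ψ} {Δ : Option (Fm Ψ)} :
      Derives σ Ψ Φ ⟨Γ, some φ⟩ → Derives σ Ψ Φ ⟨S ++ [φ] ++ P, Δ⟩ →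
      Derives σ Ψ Φ ⟨S ++ Γ ++ P, Δ⟩
  | or_left (h : Conn.or ∈ Ψ) {S Γ : List (Fm Ψ)} {φ ψ : Fm Ψ} {Δ : Option (Fm Ψ)} :
      Derives σ Ψ Φ ⟨S ++ [φ] ++ Γ, Δ⟩ → Derives σ Ψ Φ ⟨S ++ [ψ] ++ Γ, Δ⟩ →
      Derives σ Ψ Φ ⟨S ++ [.or h φ ψ] ++ Γ, Δ⟩
  | or_right₁ (h : Conn.or ∈ Ψ) {Γ : List (Fm Ψ)} {φ ψ : Fm Ψ} :
      Derives σ Ψ Φ ⟨Γ, some φ⟩ → Derives σ Ψ Φ ⟨Γ, some (.or h φ ψ)⟩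
  | or_right₂ (h : Conn.or ∈ Ψ) {Γ : List (Fm Ψ)} {φ ψ : Fm Ψ} :
      Derives σ Ψ Φ ⟨Γ, some ψ⟩ → Derives σ Ψ Φ ⟨Γ, some (.or h φ ψ)⟩
  | and_left₁ (h : Conn.and ∈ Ψ) {S Γ : List (Fm Ψ)} {φ ψ : Fm Ψ} {Δ : Option (Fm Ψ)} :
      Derives σ Ψ Φ ⟨S ++ [φ] ++ Γ, Δ⟩ → Derives σ Ψ Φ ⟨S ++ [.and h φ ψ] ++ Γ, Δ⟩
  | and_left₂ (h : Conn.and ∈ Ψ) {S Γ : List (Fm Ψ)} {φ ψ : Fm Ψ} {Δ : Option (Fm Ψ)} :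
      Derives σ Ψ Φ ⟨S ++ [ψ] ++ Γ, Δ⟩ → Derives σ Ψ Φ ⟨S ++ [.and h φ ψ] ++ Γ, Δ⟩
  | and_right (h : Conn.and ∈ Ψ) {Γ : List (Fm Ψ)} {φ ψ : Fm Ψ} :
      Derives σ Ψ Φ ⟨Γ, some φ⟩ → Derives σ Ψ Φ ⟨Γ, some ψ⟩ →
      Derives σ Ψ Φ ⟨Γ, some (.and h φ ψ)⟩
  | mul_left (h : Conn.mul ∈ Ψ) {S Γ : List (Fm Ψ)} {φ ψ : Fm Ψ} {Δ : Option (Fm Ψ)} :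
      Derives σ Ψ Φ ⟨S ++ [φ, ψ] ++ Γ, Δ⟩ → Derives σ Ψ Φ ⟨S ++ [.mul h φ ψ] ++ Γ, Δ⟩
  | mul_right (h : Conn.mul ∈ Ψ) {Γ P : List (Fm Ψ)} {φ ψ : Fm Ψ} :
      Derives σ Ψ Φ ⟨Γ, some φ⟩ → Derives σ Ψ Φ ⟨P, some ψ⟩ →
      Derives σ Ψ Φ ⟨Γ ++ P, some (.mul h φ ψ)⟩
  | rimp_left (h : Conn.rimp ∈ Ψ) {Γ S P : List (Fm Ψ)} {φ ψ : Fm Ψ} {Δ : Option (Fm Ψ)} :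
      Derives σ Ψ Φ ⟨Γ, some φ⟩ → Derives σ Ψ Φ ⟨S ++ [ψ] ++ P, Δ⟩ →
      Derives σ Ψ Φ ⟨S ++ Γ ++ [.rimp h φ ψ] ++ P, Δ⟩
  | rimp_right (h : Conn.rimp ∈ Ψ) {Γ : List (Fm Ψ)} {φ ψ : Fm Ψ} :
      Derives σ Ψ Φ ⟨[φ] ++ Γ, some ψ⟩ → Derives σ Ψ Φ ⟨Γ, some (.rimp h φ ψ)⟩
  | limp_left (h : Conn.limp ∈ Ψ) {Γ S P : List (Fm Ψ)} {φ ψ : Fm Ψ} {Δ : Option (Fm Ψ)} :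
      Derives σ Ψ Φ ⟨Γ, some φ⟩ → Derives σ Ψ Φ ⟨S ++ [ψ] ++ P, Δ⟩ →
      Derives σ Ψ Φ ⟨S ++ [.limp h ψ φ] ++ Γ ++ P, Δ⟩
  | limp_right (h : Conn.limp ∈ Ψ) {Γ : List (Fm Ψ)} {φ ψ : Fm Ψ} :
      Derives σ Ψ Φ ⟨Γ ++ [φ], some ψ⟩ → Derives σ Ψ Φ ⟨Γ, some (.limp h ψ φ)⟩
  | rneg_left (h : Conn.rneg ∈ Ψ) {Γ : List (Fm Ψ)} {φ : Fm Ψ} :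
      Derives σ Ψ Φ ⟨Γ, some φ⟩ → Derives σ Ψ Φ ⟨Γ ++ [.rneg h φ], none⟩
  | rneg_right (h : Conn.rneg ∈ Ψ) {Γ : List (Fm Ψ)} {φ : Fm Ψ} :
      Derives σ Ψ Φ ⟨[φ] ++ Γ, none⟩ → Derives σ Ψ Φ ⟨Γ, some (.rneg h φ)⟩
  | lneg_left (h : Conn.lneg ∈ Ψ) {Γ : List (Fm Ψ)} {φ : Fm Ψ} :
      Derives σ Ψ Φ ⟨Γ, some φ⟩ → Derives σ Ψ Φ ⟨[.lneg h φ] ++ Γ, none⟩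
  | lneg_right (h : Conn.lneg ∈ Ψ) {Γ : List (Fm Ψ)} {φ : Fm Ψ} :
      Derives σ Ψ Φ ⟨Γ ++ [φ], none⟩ → Derives σ Ψ Φ ⟨Γ, some (.lneg h φ)⟩
  | one_left (h : Conn.one ∈ Ψ) {S Γ : List (Fm Ψ)} {Δ : Option (Fm Ψ)} :
      Derives σ Ψ Φ ⟨S ++ Γ, Δ⟩ → Derives σ Ψ Φ ⟨S ++ [.one h] ++ Γ, Δ⟩
  | one_right (h : Conn.one ∈ Ψ) : Derives σ Ψ Φ ⟨[], some (.one h)⟩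
  | zero_left (h : Conn.zero ∈ Ψ) : Derives σ Ψ Φ ⟨[.zero h], none⟩
  | zero_right (h : Conn.zero ∈ Ψ) {Γ : List (Fm Ψ)} :
      Derives σ Ψ Φ ⟨Γ, none⟩ → Derives σ Ψ Φ ⟨Γ, some (.zero h)⟩
  | exchange (h : Letter.e ∈ σ) {Γ P : List (Fm Ψ)} {φ ψ : Fm Ψ} {Δ : Option (Fm Ψ)} :
      Derives σ Ψ Φ ⟨Γ ++ [φ, ψ] ++ P, Δ⟩ → Derives σ Ψ Φ ⟨Γ ++ [ψ, φ] ++ P, Δ⟩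
  | weak_left (h : Letter.wl ∈ σ) {S Γ : List (Fm Ψ)} {φ : Fm Ψ} {Δ : Option (Fm Ψ)} :
      Derives σ Ψ Φ ⟨S ++ Γ, Δ⟩ → Derives σ Ψ Φ ⟨S ++ [φ] ++ Γ, Δ⟩
  | weak_right (h : Letter.wr ∈ σ) {Γ : List (Fm Ψ)} {φ : Fm Ψ} :
      Derives σ Ψ Φ ⟨Γ, none⟩ → Derives σ Ψ Φ ⟨Γ, some φ⟩
  | contraction (h : Letter.c ∈ σ) {S Γ : List (Fm Ψ)} {φ : Fm Ψ} {Δ : Option (Fm Ψ)} :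
      Derives σ Ψ Φ ⟨S ++ [φ, φ] ++ Γ, Δ⟩ → Derives σ Ψ Φ ⟨S ++ [φ] ++ Γ, Δ⟩

/-- A Hilbert system in the language `Ψ`: a consequence relation on formulas that is invariant
under substitutions. -/
structure HilbertSystem (Ψ : Set Conn) where
  entails : Set (Fm Ψ) → Fm Ψ → Prop
  refl : ∀ (X : Set (Fm Ψ)) (φ : Fm Ψ), φ ∈ X → entails X φ
  trans : ∀ (X Y : Set (Fm Ψ)) (φ : Fm Ψ),
    entails X φ → (∀ ψ ∈ X, entails Y ψ) → entails Y φ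
  structural : ∀ (f : ℕ → Fm Ψ) (X : Set (Fm Ψ)) (φ : Fm Ψ),
    entails X φ → entails (Fm.subst f '' X) (Fm.subst f φ)

/-- The theories of a Hilbert system: the sets of formulas closed under consequence. -/
def HilbertSystem.IsTheory {Ψ : Set Conn} (H : HilbertSystem Ψ) (T : Set (Fm Ψ)) : Prop :=
  ∀ φ : Fm Ψ, H.entails T φ → φ ∈ T

/-- The Leibniz congruence of a set `T` of formulas: `a` and `b` are related when, for every
formula `φ`, every variable `p` and every assignment `h` of formulas to the other variables,
`φ` with `a` for `p` is in `T` iff `φ` with `b` for `p` is in `T`. -/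
def Leibniz {Ψ : Set Conn} (T : Set (Fm Ψ)) (a b : Fm Ψ) : Prop :=
  ∀ (φ : Fm Ψ) (p : ℕ) (h : ℕ → Fm Ψ),
    φ.subst (Function.update h p a) ∈ T ↔ φ.subst (Function.update h p b) ∈ T

/-- A Hilbert system is protoalgebraic when the Leibniz operator is monotone on its theories. -/
def HilbertSystem.Protoalgebraic {Ψ : Set Conn} (H : HilbertSystem Ψ) : Prop :=
  ∀ T₁ T₂ : Set (Fm Ψ), H.IsTheory T₁ → H.IsTheory T₂ → T₁ ⊆ T₂ →
    ∀ a b : Fm Ψ, Leibniz T₁ a b → Leibniz T₂ a b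

/-- The sequent with empty left side and right side `φ`. -/
def Sequent.ofFm {Ψ : Set Conn} (φ : Fm Ψ) : Sequent Ψ := ⟨[], some φ⟩

theorem Derives.trans {σ : Set Letter} {Ψ : Set Conn} {Φ Φ' : Set (Sequent Ψ)} {s : Sequent Ψ}
    (d : Derives σ Ψ Φ s) (H : ∀ t ∈ Φ, Derives σ Ψ Φ' t) : Derives σ Ψ Φ' s := by
  induction d with
  | hyp h => exact H _ h
  | ax φ => exact .ax φ
  | cut _ _ i j => exact .cut i j
  | or_left h _ _ i j => exact .or_left h i j
  | or_right₁ h _ i => exact .or_right₁ h i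
  | or_right₂ h _ i => exact .or_right₂ h i
  | and_left₁ h _ i => exact .and_left₁ h i
  | and_left₂ h _ i => exact .and_left₂ h i
  | and_right h _ _ i j => exact .and_right h i j
  | mul_left h _ i => exact .mul_left h i
  | mul_right h _ _ i j => exact .mul_right h i j
  | rimp_left h _ _ i j => exact .rimp_left h i j
  | rimp_right h _ i => exact .rimp_right h i
  | limp_left h _ _ i j => exact .limp_left h i j
  | limp_right h _ i => exact .limp_right h i
  | rneg_left h _ i => exact .rneg_left h i
  | rneg_right h _ i => exact .rneg_right h i
  | lneg_left h _ i => exact .lneg_left h i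
  | lneg_right h _ i => exact .lneg_right h i
  | one_left h _ i => exact .one_left h i
  | one_right h => exact .one_right h
  | zero_left h => exact .zero_left h
  | zero_right h _ i => exact .zero_right h i
  | exchange h _ i => exact .exchange h i
  | weak_left h _ i => exact .weak_left h i
  | weak_right h _ i => exact .weak_right h i
  | contraction h _ i => exact .contraction h i

theorem Derives.subst {σ : Set Letter} {Ψ : Set Conn} {Φ : Set (Sequent Ψ)} {s : Sequent Ψ}
    (f : ℕ → Fm Ψ) (d : Derives σ Ψ Φ s) :
    Derives σ Ψ (Sequent.subst f '' Φ) (s.subst f) := by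
  induction d with
  | hyp h => exact .hyp ⟨_, h, rfl⟩
  | ax φ => exact .ax _
  | cut _ _ i j =>
    simp only [Sequent.subst, List.map_append, List.map_cons, List.map_nil] at i j ⊢
    exact .cut i j
  | or_left h _ _ i j =>
    simp only [Sequent.subst, List.map_append, List.map_cons, List.map_nil] at i j ⊢
    exact .or_left h i j
  | or_right₁ h _ i => exact .or_right₁ h i
  | or_right₂ h _ i => exact .or_right₂ h i
  | and_left₁ h _ i =>
    simp only [Sequent.subst, List.map_append, List.map_cons, List.map_nil] at i ⊢
    exact .and_left₁ h i
  | and_left₂ h _ i =>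
    simp only [Sequent.subst, List.map_append, List.map_cons, List.map_nil] at i ⊢
    exact .and_left₂ h i
  | and_right h _ _ i j => exact .and_right h i j
  | mul_left h _ i =>
    simp only [Sequent.subst, List.map_append, List.map_cons, List.map_nil] at i ⊢
    exact .mul_left h i
  | mul_right h _ _ i j =>
    simp only [Sequent.subst, List.map_append] at i j ⊢
    exact .mul_right h i j
  | rimp_left h _ _ i j =>
    simp only [Sequent.subst, List.map_append, List.map_cons, List.map_nil] at i j ⊢
    exact .rimp_left h i j
  | rimp_right h _ i => exact .rimp_right h i
  | limp_left h _ _ i j =>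
    simp only [Sequent.subst, List.map_append, List.map_cons, List.map_nil] at i j ⊢
    exact .limp_left h i j
  | limp_right h _ i =>
    simp only [Sequent.subst, List.map_append, List.map_cons, List.map_nil] at i ⊢
    exact .limp_right h i
  | rneg_left h _ i =>
    simp only [Sequent.subst, List.map_append, List.map_cons, List.map_nil] at i ⊢
    exact .rneg_left h i
  | rneg_right h _ i => exact .rneg_right h i
  | lneg_left h _ i => exact .lneg_left h i
  | lneg_right h _ i =>
    simp only [Sequent.subst, List.map_append, List.map_cons, List.map_nil] at i ⊢
    exact .lneg_right h i
  | one_left h _ i =>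
    simp only [Sequent.subst, List.map_append, List.map_cons, List.map_nil] at i ⊢
    exact .one_left h i
  | one_right h => exact .one_right h
  | zero_left h => exact .zero_left h
  | zero_right h _ i => exact .zero_right h i
  | exchange h _ i =>
    simp only [Sequent.subst, List.map_append, List.map_cons, List.map_nil] at i ⊢
    exact .exchange h i
  | weak_left h _ i =>
    simp only [Sequent.subst, List.map_append, List.map_cons, List.map_nil] at i ⊢
    exact .weak_left h i
  | weak_right h _ i => exact .weak_right h i
  | contraction h _ i =>
    simp only [Sequent.subst, List.map_append, List.map_cons, List.map_nil] at i ⊢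
    exact .contraction h i

/-- The external system: `X` entails `φ` iff the sequent `∅ ⇒ φ` is derivable from the sequents
`∅ ⇒ ψ`, `ψ ∈ X`. -/
def external (σ : Set Letter) (Ψ : Set Conn) : HilbertSystem Ψ where
  entails X φ := Derives σ Ψ (Sequent.ofFm '' X) (Sequent.ofFm φ)
  refl _ φ h := .hyp ⟨φ, h, rfl⟩
  trans X Y φ d H := d.trans (by rintro _ ⟨ψ, hψ, rfl⟩; exact H ψ hψ)
  structural f X φ d := by
    have := d.subst f
    rw [Set.image_image] at this ⊢
    exact this

end FullLambek

/-!
A formula is evaluated in a Heyting algebra `A` by reading fusion as meet, the two implications as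
`⇨` and the two negations as `ᶜ`. Under this reading all structural rules are sound, so for every
`u : A` and every valuation the formulas whose value is at least `u` form a theory of the external
system of every `FL_σ[Ψ]` (`isTheory_filterTheory`); hence one pair of theories serves for all `σ`
at once.

Take for `A` the chain `0 < 1 < 2 < 3` and a valuation that sends two variables to the two middle
elements. Identifying `1` with `2` gives a map onto the three-element chain that preserves meets,
joins, pseudocomplements and the bounds, but not `⇨`. As no other element is identified with the
top, in a language without implications the two variables are congruent modulo the theory of the
formulas with value `3` (`leibniz_of_collapse`). They are not congruent modulo the larger theory of
the formulas with value at least `2`, because that theory contains one variable and omits the other.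
So the Leibniz operator is not monotone.
-/

namespace FullLambek

variable {A B : Type*} [HeytingAlgebra A] [HeytingAlgebra B] {σ : Set Letter} {Ψ : Set Conn}

/-! ### Heyting semantics -/

/-- The value of a formula in a Heyting algebra under a valuation of the variables. Fusion is read
as meet, both implications as `⇨`, both negations as `ᶜ`. -/
def Fm.eval (v : ℕ → A) : Fm Ψ → A
  | .var n => v n
  | .or _ φ ψ => φ.eval v ⊔ ψ.eval v
  | .and _ φ ψ => φ.eval v ⊓ ψ.eval v
  | .mul _ φ ψ => φ.eval v ⊓ ψ.eval v
  | .rimp _ φ ψ => φ.eval v ⇨ ψ.eval v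
  | .limp _ ψ φ => φ.eval v ⇨ ψ.eval v
  | .rneg _ φ => (φ.eval v)ᶜ
  | .lneg _ φ => (φ.eval v)ᶜ
  | .zero _ => ⊥
  | .one _ => ⊤

theorem Fm.eval_subst (v : ℕ → A) (f : ℕ → Fm Ψ) (φ : Fm Ψ) :
    (φ.subst f).eval v = φ.eval fun n => (f n).eval v := by
  induction φ <;> simp_all [Fm.subst, Fm.eval]

/-- The meet of the values of the formulas of a list. -/
def anteVal (v : ℕ → A) : List (Fm Ψ) → A
  | [] => ⊤
  | φ :: Γ => φ.eval v ⊓ anteVal v Γ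

theorem anteVal_append (v : ℕ → A) (Γ P : List (Fm Ψ)) :
    anteVal v (Γ ++ P) = anteVal v Γ ⊓ anteVal v P := by
  induction Γ with
  | nil => simp [anteVal]
  | cons φ Γ ih => simp [anteVal, ih, inf_assoc]

/-- The value of the right side of a sequent; the empty right side has value `⊥`. -/
def succVal (v : ℕ → A) : Option (Fm Ψ) → A
  | none => ⊥
  | some φ => φ.eval v

/-- A sequent holds relative to `u` if it holds modulo the principal filter of `u`: the left side
implies the right side below `u`. -/
def Sequent.Holds (u : A) (v : ℕ → A) (s : Sequent Ψ) : Prop :=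
  u ⊓ anteVal v s.ante ≤ succVal v s.succ

/-- Isolates one formula of the left side of a sequent. -/
theorem inf_context_le_iff {u s x p d : A} : u ⊓ (s ⊓ (x ⊓ p)) ≤ d ↔ x ≤ u ⊓ s ⊓ p ⇨ d := by
  rw [le_himp_iff]
  have : u ⊓ (s ⊓ (x ⊓ p)) = x ⊓ (u ⊓ s ⊓ p) := by ac_rfl
  rw [this]

/-- The left rules of the implications, for a context `s`, `p` and an antecedent `g`. -/
theorem inf_himp_context_le {u g s x y p d : A} (i : u ⊓ g ≤ x) (j : u ⊓ (s ⊓ (y ⊓ p)) ≤ d) :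
    u ⊓ (s ⊓ (g ⊓ ((x ⇨ y) ⊓ p))) ≤ d := by
  refine le_trans (le_inf inf_le_left ?_) j
  have : u ⊓ (s ⊓ (g ⊓ ((x ⇨ y) ⊓ p))) = s ⊓ (u ⊓ g ⊓ (x ⇨ y) ⊓ p) := by ac_rfl
  rw [this]
  exact inf_le_inf_left _ (inf_le_inf_right _ ((inf_le_inf_right _ i).trans inf_himp_le))

/-- Soundness: every rule preserves validity relative to `u`, whatever structural rules are
present. -/
theorem Derives.holds {Φ : Set (Sequent Ψ)} {s : Sequent Ψ} {u : A} {v : ℕ → A}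
    (d : Derives σ Ψ Φ s) (H : ∀ t ∈ Φ, t.Holds u v) : s.Holds u v := by
  induction d with
  | hyp h => exact H _ h
  | ax φ => simp [Sequent.Holds, anteVal, succVal]
  | zero_left h => simp [Sequent.Holds, anteVal, succVal, Fm.eval]
  | one_right h => simp [Sequent.Holds, succVal, Fm.eval]
  | cut _ _ i j =>
    simp only [Sequent.Holds, anteVal_append, anteVal, succVal, inf_top_eq, inf_assoc] at i j ⊢
    refine le_trans (le_inf inf_le_left (le_inf (inf_le_right.trans inf_le_left)
      (le_inf (le_trans ?_ i) (inf_le_right.trans (inf_le_right.trans inf_le_right))))) j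
    exact inf_le_inf_left _ (inf_le_right.trans inf_le_left)
  | or_left _ _ _ i j =>
    simp only [Sequent.Holds, anteVal_append, anteVal, succVal, Fm.eval, inf_top_eq,
      inf_assoc] at i j ⊢
    rw [inf_context_le_iff] at i j ⊢
    exact sup_le i j
  | or_right₁ _ _ i => exact le_trans i le_sup_left
  | or_right₂ _ _ i => exact le_trans i le_sup_right
  | and_left₁ _ _ i =>
    simp only [Sequent.Holds, anteVal_append, anteVal, succVal, Fm.eval, inf_top_eq] at i ⊢
    refine le_trans (inf_le_inf_left _ (inf_le_inf_right _ (inf_le_inf_left _ ?_))) i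
    exact inf_le_left
  | and_left₂ _ _ i =>
    simp only [Sequent.Holds, anteVal_append, anteVal, succVal, Fm.eval, inf_top_eq] at i ⊢
    refine le_trans (inf_le_inf_left _ (inf_le_inf_right _ (inf_le_inf_left _ ?_))) i
    exact inf_le_right
  | and_right _ _ _ i j => exact le_inf i j
  | mul_left _ _ i =>
    simp only [Sequent.Holds, anteVal_append, anteVal, succVal, Fm.eval, inf_top_eq,
      inf_assoc] at i ⊢
    exact i
  | mul_right _ _ _ i j =>
    simp only [Sequent.Holds, anteVal_append, succVal, Fm.eval] at i j ⊢
    exact le_inf ((inf_le_inf_left _ inf_le_left).trans i)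
      ((inf_le_inf_left _ inf_le_right).trans j)
  | rimp_left _ _ _ i j =>
    simp only [Sequent.Holds, anteVal_append, anteVal, succVal, Fm.eval, inf_top_eq,
      inf_assoc] at i j ⊢
    exact inf_himp_context_le i j
  | rimp_right _ _ i =>
    simp only [Sequent.Holds, anteVal_append, anteVal, succVal, Fm.eval, inf_top_eq] at i ⊢
    rw [le_himp_iff]
    exact le_trans (le_of_eq (by ac_rfl)) i
  | limp_left _ _ _ i j =>
    simp only [Sequent.Holds, anteVal_append, anteVal, succVal, Fm.eval, inf_top_eq,
      inf_assoc] at i j ⊢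
    rw [inf_left_comm (_ ⇨ _)]
    exact inf_himp_context_le i j
  | limp_right _ _ i =>
    simp only [Sequent.Holds, anteVal_append, anteVal, succVal, Fm.eval, inf_top_eq] at i ⊢
    rw [le_himp_iff]
    exact le_trans (le_of_eq (by ac_rfl)) i
  | rneg_left _ _ i =>
    simp only [Sequent.Holds, anteVal_append, anteVal, succVal, Fm.eval, inf_top_eq,
      ← himp_bot] at i ⊢
    rw [← inf_assoc]
    exact (inf_le_inf_right _ i).trans inf_himp_le
  | rneg_right _ _ i =>
    simp only [Sequent.Holds, anteVal_append, anteVal, succVal, Fm.eval, inf_top_eq,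
      ← himp_bot] at i ⊢
    rw [le_himp_iff]
    exact le_trans (le_of_eq (by ac_rfl)) i
  | lneg_left _ _ i =>
    simp only [Sequent.Holds, anteVal_append, anteVal, succVal, Fm.eval, inf_top_eq,
      ← himp_bot] at i ⊢
    rw [inf_left_comm]
    exact (inf_le_inf_left _ i).trans himp_inf_le
  | lneg_right _ _ i =>
    simp only [Sequent.Holds, anteVal_append, anteVal, succVal, Fm.eval, inf_top_eq,
      ← himp_bot] at i ⊢
    rw [le_himp_iff]
    exact le_trans (le_of_eq (by ac_rfl)) i
  | one_left _ _ i =>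
    simp only [Sequent.Holds, anteVal_append, anteVal, succVal, Fm.eval, inf_top_eq] at i ⊢
    simpa using i
  | zero_right _ _ i => exact i
  | exchange _ _ i =>
    simp only [Sequent.Holds, anteVal_append, anteVal, succVal, inf_top_eq, inf_assoc] at i ⊢
    exact le_trans (le_of_eq (by ac_rfl)) i
  | weak_left _ _ i =>
    simp only [Sequent.Holds, anteVal_append, anteVal, succVal, inf_top_eq, inf_assoc] at i ⊢
    exact (inf_le_inf_left _ (inf_le_inf_left _ inf_le_right)).trans i
  | weak_right _ _ i => exact le_trans i bot_le
  | contraction _ _ i =>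
    simp only [Sequent.Holds, anteVal_append, anteVal, succVal, inf_top_eq, inf_assoc] at i ⊢
    simpa only [← inf_assoc, inf_right_idem] using i

/-- The formulas whose value is at least `u`. -/
def filterTheory (Ψ : Set Conn) (u : A) (v : ℕ → A) : Set (Fm Ψ) := {φ | u ≤ φ.eval v}

theorem isTheory_filterTheory (σ : Set Letter) (Ψ : Set Conn) (u : A) (v : ℕ → A) :
    (external σ Ψ).IsTheory (filterTheory Ψ u v) := by
  intro φ d
  have h := Derives.holds (u := u) (v := v) d <| by
    rintro _ ⟨ψ, hψ, rfl⟩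
    exact inf_le_left.trans hψ
  simpa [Sequent.Holds, Sequent.ofFm, anteVal, succVal, filterTheory] using h

/-! ### Collapsing a chain -/

/-- Implication is the only operation that `f` need not preserve. -/
theorem Fm.map_eval {F : Type*} [FunLike F A B] [BoundedLatticeHomClass F A B] (f : F)
    (hf : ∀ x, f xᶜ = (f x)ᶜ) (hr : Conn.rimp ∉ Ψ) (hl : Conn.limp ∉ Ψ) (v : ℕ → A) (φ : Fm Ψ) :
    f (φ.eval v) = φ.eval (f ∘ v) := by
  induction φ <;> simp_all [Fm.eval]

/-- If a bounded lattice homomorphism preserves pseudocomplements and sends only `⊤` to `⊤`, then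
in a language without implications its kernel is compatible with the theory of the formulas with
value `⊤`. -/
theorem leibniz_of_collapse {F : Type*} [FunLike F A B] [BoundedLatticeHomClass F A B] (f : F)
    (hf : ∀ x, f xᶜ = (f x)ᶜ) (htop : ∀ x, f x = ⊤ → x = ⊤)
    (hr : Conn.rimp ∉ Ψ) (hl : Conn.limp ∉ Ψ) {v : ℕ → A} {a b : Fm Ψ}
    (hab : f (a.eval v) = f (b.eval v)) : Leibniz (filterTheory Ψ ⊤ v) a b := by
  intro φ p h
  have mem_iff (ψ : Fm Ψ) : ψ ∈ filterTheory Ψ ⊤ v ↔ f (ψ.eval v) = ⊤ :=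
    top_le_iff.trans ⟨fun e => by rw [e, map_top], htop _⟩
  have key : f ((φ.subst (Function.update h p a)).eval v) =
      f ((φ.subst (Function.update h p b)).eval v) := by
    rw [Fm.eval_subst, Fm.eval_subst, Fm.map_eval f hf hr hl, Fm.map_eval f hf hr hl]
    congr 1
    funext n
    by_cases hn : n = p
    · subst hn; simpa using hab
    · simp [hn]
  rw [mem_iff, mem_iff, key]

/-- The map from the four-element chain onto the three-element chain that identifies the two middle
elements. -/
def chainCollapse : BoundedLatticeHom (Fin 4) (Fin 3) where
  toFun := ![0, 1, 1, 2]
  map_sup' := by decide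
  map_inf' := by decide
  map_top' := by decide
  map_bot' := by decide

theorem not_protoalgebraic (σ : Set Letter) (hr : Conn.rimp ∉ Ψ) (hl : Conn.limp ∉ Ψ) :
    ¬ (external σ Ψ).Protoalgebraic := by
  intro H
  let v : ℕ → Fin 4 := fun n => if n = 0 then 1 else 2
  have h₁ : Leibniz (filterTheory Ψ ⊤ v) (.var 0) (.var 1) :=
    leibniz_of_collapse chainCollapse (by decide) (by decide) hr hl rfl
  have h₂ := H _ _ (isTheory_filterTheory σ Ψ ⊤ v) (isTheory_filterTheory σ Ψ 2 v)
    (fun _ h => le_trans (le_top (a := (2 : Fin 4))) h) _ _ h₁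
  -- The context `var 0`, with the two variables put for its variable, separates their values.
  have h₃ := h₂ (.var 0) 0 .var
  have h₄ : (2 : Fin 4) ≤ 1 ↔ (2 : Fin 4) ≤ 2 := h₃
  exact absurd h₄ (by decide)

end FullLambek

open FullLambek in
theorem theorem29 (σ : Set Letter) :
    ¬ (external σ {Conn.or, Conn.mul, Conn.zero, Conn.one}).Protoalgebraic ∧
    ¬ (external σ {Conn.or, Conn.and, Conn.mul, Conn.zero, Conn.one}).Protoalgebraic ∧
    ¬ (external σ {Conn.or, Conn.mul, Conn.rneg, Conn.lneg, Conn.zero,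
        Conn.one}).Protoalgebraic ∧
    ¬ (external σ {Conn.or, Conn.and, Conn.mul, Conn.rneg, Conn.lneg, Conn.zero,
        Conn.one}).Protoalgebraic := by
  refine ⟨?_, ?_, ?_, ?_⟩ <;> exact not_protoalgebraic σ (by simp) (by simp)
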